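/- Let $a,b\in\mathbb{R}$ and let $V=(ax+yz)\,\partial_x+(by+xz)\,\partial_y+(z+xy)\,\partial_z$ on $\mathbb{R}^3$. A Darboux polynomial of $V$ with cofactor $k\in\mathbb{R}[x,y,z]$ is a nonzero $f\in\mathbb{R}[x,y,z]$ with $\mathcal{L}_V f=kf$, where $\mathcal{L}_V f$ is the Lie derivative of $f$ along $V$. Then $V$ possesses the following Darboux polynomials: - $x^2-z^2$, with cofactor $2$, if $a=1$; - $y^2-z^2$, with cofactor $2$, if $b=1$; - $x^2-y^2$, with cofactor $2a$, if $a=b$. All other Darboux polynomials with constant cofactor are generated from these: for all $a,b$, every Darboux polynomial of $V$ with constant cofactor is obtained from those of the three polynomials whose condition on $(a,b)$ holds, together with the real constants (which have cofactor $0$), by finitely many products and sums of polynomials with the same cofactor. Moreover, every Darboux polynomial of $V$, with arbitrary polynomial cofactor, divides a Darboux polynomial with constant cofactor that is generated in this way. -/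

import Mathlib

open MvPolynomial

noncomputable section

/-- The Lie derivative `∑ i, vᵢ ∂f/∂xᵢ` of a real polynomial in `n` variables along the polynomial
vector field with components `vᵢ`. -/
def lieDeriv {n : ℕ} (v : Fin n → MvPolynomial (Fin n) ℝ) (f : MvPolynomial (Fin n) ℝ) :
    MvPolynomial (Fin n) ℝ :=
  ∑ i, v i * pderiv i f

/-- `f` is a Darboux polynomial of the vector field `v`, with (polynomial) cofactor `k`. -/
def IsDarboux {n : ℕ} (v : Fin n → MvPolynomial (Fin n) ℝ) (f k : MvPolynomial (Fin n) ℝ) :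
    Prop :=
  f ≠ 0 ∧ lieDeriv v f = k * f

/-- `DarbouxGenerated v S f k`: the polynomial `f`, with cofactor `k`, is obtained from the
Darboux polynomials of `v` belonging to `S` and from real constants (which have cofactor `0`)
by finitely many sums of polynomials with the same cofactor and products. -/
inductive DarbouxGenerated {n : ℕ} (v : Fin n → MvPolynomial (Fin n) ℝ)
    (S : Set (MvPolynomial (Fin n) ℝ)) :
    MvPolynomial (Fin n) ℝ → MvPolynomial (Fin n) ℝ → Prop
  | basic {f k : MvPolynomial (Fin n) ℝ} (hS : f ∈ S) (hf : IsDarboux v f k) :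
      DarbouxGenerated v S f k
  | const (r : ℝ) : DarbouxGenerated v S (C r) 0
  | add {f g k : MvPolynomial (Fin n) ℝ} (hf : DarbouxGenerated v S f k)
      (hg : DarbouxGenerated v S g k) : DarbouxGenerated v S (f + g) k
  | mul {f g k l : MvPolynomial (Fin n) ℝ} (hf : DarbouxGenerated v S f k)
      (hg : DarbouxGenerated v S g l) : DarbouxGenerated v S (f * g) (k + l)

/-- The vector field `(a x + y z) ∂x + (b y + x z) ∂y + (z + x y) ∂z` on `ℝ³`, where
`x = X 0`, `y = X 1`, `z = X 2`. -/
def d2PlusField (a b : ℝ) : Fin 3 → MvPolynomial (Fin 3) ℝ :=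
  ![C a * X 0 + X 1 * X 2, C b * X 1 + X 0 * X 2, X 2 + X 0 * X 1]

/-- The basic Darboux polynomials available at the parameters `a`, `b`: `x² - z²` if `a = 1`,
`y² - z²` if `b = 1`, and `x² - y²` if `a = b`. -/
def d2PlusBasic (a b : ℝ) : Set (MvPolynomial (Fin 3) ℝ) :=
  {f | (a = 1 ∧ f = X 0 ^ 2 - X 2 ^ 2) ∨ (b = 1 ∧ f = X 1 ^ 2 - X 2 ^ 2) ∨
    (a = b ∧ f = X 0 ^ 2 - X 1 ^ 2)}

end

/-!
Write `V = V₀ + V₁` with `V₀ = linearPart a b` and `V₁ = quadraticPart`, and put `α = x² - z²`,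
`β = y² - z²`, `T = z²`.

Every polynomial is, in a unique way, a sum over the sets `s` of variables of terms `(∏ i ∈ s, xᵢ) h`
with `h ∈ ℝ[x², y², z²] = ℝ[α, β][T]`. As `V₁` kills `α` and `β`, and `V₁ T = 2xyz`, it sends the
parity class `s` to the complementary class by `h ↦ p' h + 2 p h'`, where the prime is `∂/∂T` and
`p = ∏ i ∈ s, xᵢ²` is monic in `T`. Looking at the leading coefficient in `T` gives two facts:
the kernel of `V₁` is `ℝ[α, β]` (`exists_integralHom_eq`), and a nonzero element of the image of
`V₁` lying in `ℝ[x², y², z²]` has degree at least two in `T` (`eq_zero_of_lieDerivation_eq_evenHom`).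

Let `V f = c f` with `c` constant. If the component `f_{m+1}` satisfies `V₀ f_{m+1} = c f_{m+1}`,
then `V₁ f_m = 0`, so that `f_m = F(α, β)`. Moreover `V₁ f_{m-1} = (c - V₀) f_m`
(with `f_{-1} = 0`) is of degree at most
one in `T`, hence zero, and `V₀ f_m = c f_m`. By descending induction this holds for all components
(`lieDerivation_homogeneousComponent`), and it amounts to the two equations
`c F = 2(a α F_α + b β F_β)` and `(a - 1) F_α + (b - 1) F_β = 0`. They are solved by comparing
coefficients, in `α`, `β` if `a ≠ b` and in `α - β`, `β` if `a = b`; only monomials in the basic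
Darboux polynomials survive, all with cofactor `c`.

For an arbitrary cofactor `k`, the degree of `k` is at most one, and the four sign changes of the
coordinates with product `1` preserve `V`. The product of the four images of `f` is a Darboux
polynomial divisible by `f`; its cofactor is the sum of the images of `k`, in which the linear terms
cancel (`IsDarboux.exists_dvd_isDarboux_C`).
-/

/-! ### The Lie derivative as a derivation -/

/-- The Lie derivative along `v`, bundled as a derivation of the polynomial ring. -/
noncomputable def lieDerivation {n : ℕ} (v : Fin n → MvPolynomial (Fin n) ℝ) :
    Derivation ℝ (MvPolynomial (Fin n) ℝ) (MvPolynomial (Fin n) ℝ) :=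
  ∑ i, v i • pderiv i

theorem lieDeriv_eq_lieDerivation {n : ℕ} (v : Fin n → MvPolynomial (Fin n) ℝ)
    (f : MvPolynomial (Fin n) ℝ) : lieDeriv v f = lieDerivation v f := by
  have h := map_sum (Derivation.coeFnAddMonoidHom (R := ℝ) (A := MvPolynomial (Fin n) ℝ)
    (M := MvPolynomial (Fin n) ℝ)) (fun i => v i • pderiv i) Finset.univ
  have h' := congrFun h f
  simp only [Finset.sum_apply] at h'
  exact h'.symm

theorem lieDerivation_X {n : ℕ} (v : Fin n → MvPolynomial (Fin n) ℝ) (i : Fin n) :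
    lieDerivation v (X i) = v i := by
  rw [← lieDeriv_eq_lieDerivation, lieDeriv]
  simp [pderiv_X, Pi.single_apply]

theorem lieDerivation_C {n : ℕ} (v : Fin n → MvPolynomial (Fin n) ℝ) (r : ℝ) :
    lieDerivation v (C r) = 0 :=
  derivation_C _ r

theorem lieDerivation_add {n : ℕ} (v w : Fin n → MvPolynomial (Fin n) ℝ)
    (f : MvPolynomial (Fin n) ℝ) :
    lieDerivation (v + w) f = lieDerivation v f + lieDerivation w f := by
  simp [← lieDeriv_eq_lieDerivation, lieDeriv, add_mul, Finset.sum_add_distrib]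

/-- A vector field that is homogeneous of degree `d + 1` raises degrees by `d`. -/
theorem MvPolynomial.IsHomogeneous.lieDerivation {n : ℕ} {v : Fin n → MvPolynomial (Fin n) ℝ}
    {d m : ℕ} (hv : ∀ i, (v i).IsHomogeneous (d + 1)) {f : MvPolynomial (Fin n) ℝ}
    (hf : f.IsHomogeneous m) : (lieDerivation v f).IsHomogeneous (m + d) := by
  rw [← lieDeriv_eq_lieDerivation, lieDeriv]
  refine IsHomogeneous.sum _ _ _ fun i _ => ?_
  cases m with
  | zero =>
    rw [totalDegree_eq_zero_iff_eq_C.1 (Nat.le_zero.1 hf.totalDegree_le), pderiv_C, mul_zero]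
    exact isHomogeneous_zero _ _ _
  | succ m =>
    have := (hv i).mul (hf.pderiv (i := i))
    convert this using 1
    omega

theorem homogeneousComponent_lieDerivation {n : ℕ} {v : Fin n → MvPolynomial (Fin n) ℝ}
    {d : ℕ} (hv : ∀ i, (v i).IsHomogeneous (d + 1)) (f : MvPolynomial (Fin n) ℝ) (m : ℕ) :
    homogeneousComponent (m + d) (lieDerivation v f) =
      lieDerivation v (homogeneousComponent m f) := by
  conv_lhs => rw [← sum_homogeneousComponent f]
  conv_rhs => rw [← sum_homogeneousComponent f]
  simp only [map_sum]
  refine Finset.sum_congr rfl fun i _ => ?_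
  have hi := homogeneousComponent_isHomogeneous i f
  rw [homogeneousComponent_of_mem (n := i + d) (hi.lieDerivation hv),
    homogeneousComponent_of_mem (n := i) hi]
  by_cases h : m = i <;> simp [h]

theorem homogeneousComponent_lieDerivation_of_lt {n : ℕ} {v : Fin n → MvPolynomial (Fin n) ℝ}
    {d : ℕ} (hv : ∀ i, (v i).IsHomogeneous (d + 1)) (f : MvPolynomial (Fin n) ℝ) {m : ℕ}
    (hm : m < d) : homogeneousComponent m (lieDerivation v f) = 0 := by
  conv_lhs => rw [← sum_homogeneousComponent f]
  simp only [map_sum]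
  refine Finset.sum_eq_zero fun i _ => ?_
  rw [homogeneousComponent_of_mem (n := i + d)
    ((homogeneousComponent_isHomogeneous i f).lieDerivation hv), if_neg (by omega)]

theorem totalDegree_lieDerivation_le {n : ℕ} {v : Fin n → MvPolynomial (Fin n) ℝ}
    {d : ℕ} (hv : ∀ i, (v i).totalDegree ≤ d + 1) (f : MvPolynomial (Fin n) ℝ) :
    (lieDerivation v f).totalDegree ≤ f.totalDegree + d := by
  rw [← lieDeriv_eq_lieDerivation, lieDeriv]
  refine (totalDegree_finsetSum _ _).trans (Finset.sup_le fun i _ => ?_)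
  by_cases hf : pderiv i f = 0
  · simp [hf]
  refine (totalDegree_mul _ _).trans ?_
  have h1 : (pderiv i f).totalDegree + 1 ≤ f.totalDegree := by
    obtain ⟨m, hm, hdeg⟩ := Finset.exists_mem_eq_sup (pderiv i f).support
      (support_nonempty.2 hf) (fun s : Fin n →₀ ℕ => s.sum fun _ e => e)
    have hm' : m + Finsupp.single i 1 ∈ f.support := by
      rw [mem_support_iff] at hm ⊢
      intro h
      rw [coeff_pderiv, h, zero_mul] at hm
      exact hm rfl
    have h2 := le_totalDegree hm'
    rw [Finsupp.sum_add_index' (fun _ => rfl) (fun _ _ _ => rfl),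
      Finsupp.sum_single_index rfl] at h2
    rw [totalDegree, hdeg]
    exact h2
  have := hv i
  omega

/-! ### The linear and quadratic parts of the vector field -/

/-- The linear part `a x ∂x + b y ∂y + z ∂z`. -/
noncomputable def linearPart (a b : ℝ) : Fin 3 → MvPolynomial (Fin 3) ℝ :=
  ![C a * X 0, C b * X 1, X 2]

/-- The quadratic part `y z ∂x + x z ∂y + x y ∂z`. -/
noncomputable def quadraticPart : Fin 3 → MvPolynomial (Fin 3) ℝ :=
  ![X 1 * X 2, X 0 * X 2, X 0 * X 1]

theorem d2PlusField_eq (a b : ℝ) : d2PlusField a b = linearPart a b + quadraticPart := by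
  funext i
  fin_cases i <;> simp [d2PlusField, linearPart, quadraticPart]

theorem linearPart_isHomogeneous (a b : ℝ) (i : Fin 3) :
    (linearPart a b i).IsHomogeneous (0 + 1) := by
  fin_cases i
  · exact (isHomogeneous_X _ _).C_mul _
  · exact (isHomogeneous_X _ _).C_mul _
  · exact isHomogeneous_X _ _

theorem quadraticPart_isHomogeneous (i : Fin 3) :
    (quadraticPart i).IsHomogeneous (1 + 1) := by
  fin_cases i <;> exact (isHomogeneous_X _ _).mul (isHomogeneous_X _ _)

theorem totalDegree_d2PlusField_le (a b : ℝ) (i : Fin 3) :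
    (d2PlusField a b i).totalDegree ≤ 1 + 1 := by
  rw [d2PlusField_eq]
  refine (totalDegree_add _ _).trans (max_le ?_ ?_)
  · exact (linearPart_isHomogeneous a b i).totalDegree_le.trans (by norm_num)
  · exact (quadraticPart_isHomogeneous i).totalDegree_le

/-! ### Parity decomposition of polynomials in three variables -/

/-- Polynomials in `T = z²` whose coefficients are polynomials in `α = x² - z²` (the variable
`X 0`) and `β = y² - z²` (the variable `X 1`). -/
abbrev EvenRing : Type := Polynomial (MvPolynomial (Fin 2) ℝ)

/-- The embedding of `ℝ[α, β]` into `ℝ[x, y, z]` with `α ↦ x² - z²` and `β ↦ y² - z²`. -/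
noncomputable def integralHom : MvPolynomial (Fin 2) ℝ →ₐ[ℝ] MvPolynomial (Fin 3) ℝ :=
  aeval ![X 0 ^ 2 - X 2 ^ 2, X 1 ^ 2 - X 2 ^ 2]

/-- The embedding of `ℝ[α, β][T]` into `ℝ[x, y, z]`; its image is `ℝ[x², y², z²]`. -/
noncomputable def evenHom : EvenRing →+* MvPolynomial (Fin 3) ℝ :=
  Polynomial.eval₂RingHom integralHom.toRingHom (X 2 ^ 2)

/-- The elements of `ℝ[α, β][T]` representing `x²`, `y²` and `z²`. -/
noncomputable def squareCoord : Fin 3 → EvenRing :=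
  ![Polynomial.X + Polynomial.C (X 0), Polynomial.X + Polynomial.C (X 1), Polynomial.X]

theorem evenHom_C (F : MvPolynomial (Fin 2) ℝ) : evenHom (Polynomial.C F) = integralHom F := by
  simp [evenHom]

theorem evenHom_X : evenHom Polynomial.X = X 2 ^ 2 := by
  simp [evenHom]

theorem integralHom_C (r : ℝ) : integralHom (C r) = C r := by
  simp [integralHom]

theorem integralHom_X_zero : integralHom (X 0) = X 0 ^ 2 - X 2 ^ 2 := by
  simp [integralHom]

theorem integralHom_X_one : integralHom (X 1) = X 1 ^ 2 - X 2 ^ 2 := by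
  simp [integralHom]

theorem evenHom_squareCoord (i : Fin 3) : evenHom (squareCoord i) = X i ^ 2 := by
  fin_cases i <;>
    simp [squareCoord, evenHom_C, evenHom_X, integralHom_X_zero, integralHom_X_one]

/-- `evenHom` is an invertible linear change of variables followed by squaring the variables. -/
theorem exists_evenHom_eq_expand : ∃ l : EvenRing →+* MvPolynomial (Fin 3) ℝ,
    Function.Injective l ∧ ∀ h, evenHom h = expand 2 (l h) := by
  let l : EvenRing →+* MvPolynomial (Fin 3) ℝ := Polynomial.eval₂RingHom
    (aeval (R := ℝ) (![X 0 - X 2, X 1 - X 2] : Fin 2 → MvPolynomial (Fin 3) ℝ)).toRingHom (X 2)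
  let m : MvPolynomial (Fin 3) ℝ →+* EvenRing := (aeval (R := ℝ) squareCoord).toRingHom
  have hml : m.comp l = RingHom.id _ := by
    ext i
    · simp [m, l]
    · fin_cases i <;> simp [m, l, squareCoord]
    · simp [m, l, squareCoord]
  have hl : evenHom = (expand 2).toRingHom.comp l := by
    ext i
    · simp [evenHom, l, integralHom]
    · fin_cases i <;> simp [evenHom, l, integralHom]
    · simp [evenHom, l]
  refine ⟨l, Function.LeftInverse.injective (g := m) fun h => ?_, fun h => ?_⟩
  · exact DFunLike.congr_fun hml h
  · exact DFunLike.congr_fun hl h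

theorem exists_parity_decomposition (f : MvPolynomial (Fin 3) ℝ) :
    ∃ h : Finset (Fin 3) → EvenRing, f = ∑ s, (∏ i ∈ s, X i) * evenHom (h s) := by
  induction f using MvPolynomial.induction_on' with
  | monomial m r =>
    classical
    refine ⟨Pi.single (Finset.univ.filter fun i => m i % 2 = 1)
      (Polynomial.C (C r) * ∏ i, squareCoord i ^ (m i / 2)), ?_⟩
    have hsum : ∑ s, (∏ i ∈ s, X i) * evenHom ((Pi.single (Finset.univ.filter fun i => m i % 2 = 1)
        (Polynomial.C (C r) * ∏ i, squareCoord i ^ (m i / 2)) : Finset (Fin 3) → EvenRing) s) =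
        (∏ i ∈ Finset.univ.filter fun i => m i % 2 = 1, X i) *
          evenHom (Polynomial.C (C r) * ∏ i, squareCoord i ^ (m i / 2)) := by
      rw [Finset.sum_eq_single (Finset.univ.filter fun i => m i % 2 = 1), Pi.single_eq_same]
      · intro s _ hs
        rw [Pi.single_eq_of_ne hs, map_zero, mul_zero]
      · exact fun h => absurd (Finset.mem_univ _) h
    have hev : evenHom (Polynomial.C (C r) * ∏ i, squareCoord i ^ (m i / 2)) =
        C r * ∏ i, evenHom (squareCoord i ^ (m i / 2)) := by
      rw [map_mul, map_prod, evenHom_C, integralHom_C]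
    rw [hsum, hev, Finset.prod_filter, mul_left_comm, ← Finset.prod_mul_distrib, monomial_eq,
      Finsupp.prod_fintype _ _ (fun _ => pow_zero _)]
    refine congrArg (C r * ·) (Finset.prod_congr rfl fun i _ => ?_)
    rw [map_pow, evenHom_squareCoord, ← pow_mul]
    conv_lhs => rw [← Nat.mod_add_div (m i) 2, pow_add]
    refine congrArg (· * X i ^ (2 * (m i / 2))) ?_
    rcases Nat.mod_two_eq_zero_or_one (m i) with h | h <;> simp [h]
  | add p q hp hq =>
    obtain ⟨h, rfl⟩ := hp
    obtain ⟨k, rfl⟩ := hq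
    exact ⟨h + k, by simp [mul_add, Finset.sum_add_distrib]⟩

theorem eq_zero_of_parity_decomposition {h : Finset (Fin 3) → EvenRing}
    (h0 : ∑ s, (∏ i ∈ s, X i) * evenHom (h s) = 0) (t : Finset (Fin 3)) : h t = 0 := by
  classical
  obtain ⟨l, hl, hexp⟩ := exists_evenHom_eq_expand
  -- the exponent vector of `∏ i ∈ s, X i`
  let e : Finset (Fin 3) → Fin 3 →₀ ℕ := fun s => ∑ i ∈ s, Finsupp.single i 1
  have he : ∀ s j, e s j = if j ∈ s then 1 else 0 := fun s j => by
    simp [e, Finsupp.finsetSum_apply, Finsupp.single_apply]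
  have hX : ∀ s : Finset (Fin 3), ∏ i ∈ s, (X i : MvPolynomial (Fin 3) ℝ) = monomial (e s) 1 :=
    fun s => (monomial_sum_one s _).symm
  apply (map_eq_zero_iff l hl).1
  ext n
  have key := congrArg (coeff (e t + 2 • n)) h0
  rw [coeff_sum, Finset.sum_eq_single t] at key
  · rwa [hX, hexp, coeff_monomial_mul, one_mul, coeff_expand_smul _ two_ne_zero] at key
  · intro s _ hst
    rw [hX, hexp, coeff_monomial_mul']
    split_ifs with hle
    · have : ∃ j, ¬ (j ∈ s ↔ j ∈ t) := by
        by_contra! hc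
        exact hst (Finset.ext hc)
      obtain ⟨j, hj⟩ := this
      rw [coeff_expand_of_not_dvd _ (i := j), mul_zero]
      have h1 := hle j
      simp only [Finsupp.tsub_apply, Finsupp.add_apply, Finsupp.smul_apply, he,
        smul_eq_mul] at h1 ⊢
      by_cases hs : j ∈ s <;> by_cases ht : j ∈ t <;> simp [hs, ht] at hj h1 ⊢; omega
    · rfl
  · exact fun h => absurd (Finset.mem_univ _) h

/-! ### The quadratic part in parity coordinates -/

theorem lieDerivation_quadraticPart_integralHom (F : MvPolynomial (Fin 2) ℝ) :
    lieDerivation quadraticPart (integralHom F) = 0 := by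
  induction F using MvPolynomial.induction_on with
  | C r => rw [integralHom_C, lieDerivation_C]
  | add p q hp hq => rw [map_add, map_add, hp, hq, add_zero]
  | mul_X p i hp =>
    have hi : lieDerivation quadraticPart (integralHom (X i)) = 0 := by
      fin_cases i
      · simp [integralHom_X_zero, Derivation.leibniz_pow, lieDerivation_X, quadraticPart]
        ring
      · simp [integralHom_X_one, Derivation.leibniz_pow, lieDerivation_X, quadraticPart]
        ring
    rw [map_mul, Derivation.leibniz, hp, hi, smul_zero, smul_zero, add_zero]

/-- On `ℝ[x², y², z²]` the quadratic part acts as `2xyz ∂/∂T`. -/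
theorem lieDerivation_quadraticPart_evenHom (h : EvenRing) :
    lieDerivation quadraticPart (evenHom h) =
      2 * (X 0 * X 1 * X 2) * evenHom (Polynomial.derivative h) := by
  induction h using Polynomial.induction_on' with
  | add p q hp hq => simp only [map_add, hp, hq, mul_add]
  | monomial n F =>
    rw [Polynomial.derivative_monomial, ← Polynomial.C_mul_X_pow_eq_monomial,
      ← Polynomial.C_mul_X_pow_eq_monomial]
    simp only [map_mul, map_pow, evenHom_C, evenHom_X, Derivation.leibniz,
      Derivation.leibniz_pow, lieDerivation_quadraticPart_integralHom, lieDerivation_X,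
      map_natCast, smul_zero, add_zero]
    cases n with
    | zero => simp
    | succ n =>
      simp [quadraticPart]
      ring

/-- The quadratic part maps the parity class of `∏ i ∈ s, X i` to the complementary class. Its value
on `∏ i ∈ s, X i` is found from `(∏ i ∈ s, X i)² = evenHom (∏ i ∈ s, squareCoord i)`. -/
theorem lieDerivation_quadraticPart_prod_mul (s : Finset (Fin 3)) (h : EvenRing) :
    lieDerivation quadraticPart ((∏ i ∈ s, X i) * evenHom h) =
      (∏ i ∈ sᶜ, X i) * evenHom (Polynomial.derivative (∏ i ∈ s, squareCoord i) * h +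
        2 * ((∏ i ∈ s, squareCoord i) * Polynomial.derivative h)) := by
  set P : MvPolynomial (Fin 3) ℝ := ∏ i ∈ s, X i with hP
  set Q : MvPolynomial (Fin 3) ℝ := ∏ i ∈ sᶜ, X i with hQ
  set p : EvenRing := ∏ i ∈ s, squareCoord i with hp
  have hPQ : X 0 * X 1 * X 2 = P * Q := by
    rw [hP, hQ, Finset.prod_mul_prod_compl, Fin.prod_univ_three]
  have hP2 : evenHom p = P ^ 2 := by
    rw [hp, hP, map_prod, ← Finset.prod_pow]
    exact Finset.prod_congr rfl fun i _ => evenHom_squareCoord i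
  have hP0 : P ≠ 0 := Finset.prod_ne_zero_iff.2 fun i _ => X_ne_zero i
  have hdP : lieDerivation quadraticPart P = Q * evenHom (Polynomial.derivative p) := by
    have h1 := lieDerivation_quadraticPart_evenHom p
    rw [hP2, Derivation.leibniz_pow, hPQ] at h1
    apply mul_left_cancel₀ (mul_ne_zero two_ne_zero hP0)
    simp only [Nat.add_one_sub_one, pow_one, smul_eq_mul, nsmul_eq_mul, Nat.cast_ofNat] at h1
    linear_combination h1
  rw [Derivation.leibniz, hdP, lieDerivation_quadraticPart_evenHom, hPQ]
  simp only [map_add, map_mul, map_ofNat, hP2, smul_eq_mul]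
  ring

theorem coeff_X_mul_derivative {R : Type*} [CommRing R] (p : Polynomial R) (n : ℕ) :
    (Polynomial.X * Polynomial.derivative p).coeff n = n * p.coeff n := by
  cases n with
  | zero => simp
  | succ n =>
    rw [Polynomial.coeff_X_mul, Polynomial.coeff_derivative]
    push_cast
    ring

/-- The leading coefficient of `p' h + 2 p h'` for monic `p`. -/
theorem coeff_derivative_mul_add {R : Type*} [CommRing R] {p : Polynomial R} (hp : p.Monic)
    (h : Polynomial R) {n : ℕ} (hn : p.natDegree + h.natDegree = n + 1) :
    (Polynomial.derivative p * h + 2 * (p * Polynomial.derivative h)).coeff n =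
      (p.natDegree + 2 * h.natDegree : ℕ) * h.leadingCoeff := by
  have hX : ∀ q : Polynomial R, (Polynomial.X * Polynomial.derivative q).natDegree ≤
      q.natDegree := fun q => by
    rw [Polynomial.natDegree_le_iff_coeff_eq_zero]
    intro k hk
    rw [coeff_X_mul_derivative, Polynomial.coeff_eq_zero_of_natDegree_lt hk, mul_zero]
  rw [← Polynomial.coeff_X_mul, ← hn]
  have : Polynomial.X * (Polynomial.derivative p * h + 2 * (p * Polynomial.derivative h)) =
      (Polynomial.X * Polynomial.derivative p) * h +
        (p * (Polynomial.X * Polynomial.derivative h) +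
          p * (Polynomial.X * Polynomial.derivative h)) := by ring
  rw [this, Polynomial.coeff_add, Polynomial.coeff_add,
    Polynomial.coeff_mul_add_eq_of_natDegree_le (hX p) le_rfl,
    Polynomial.coeff_mul_add_eq_of_natDegree_le le_rfl (hX h), coeff_X_mul_derivative,
    coeff_X_mul_derivative, hp.coeff_natDegree]
  push_cast
  simp only [Polynomial.coeff_natDegree]
  ring

theorem squareCoord_monic (i : Fin 3) : (squareCoord i).Monic := by
  fin_cases i
  · exact Polynomial.monic_X_add_C _
  · exact Polynomial.monic_X_add_C _
  · exact Polynomial.monic_X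

theorem natDegree_squareCoord (i : Fin 3) : (squareCoord i).natDegree = 1 := by
  fin_cases i
  · exact Polynomial.natDegree_X_add_C _
  · exact Polynomial.natDegree_X_add_C _
  · exact Polynomial.natDegree_X

theorem natDegree_prod_squareCoord (s : Finset (Fin 3)) :
    (∏ i ∈ s, squareCoord i).natDegree = s.card := by
  rw [Polynomial.natDegree_prod_of_monic _ _ fun i _ => squareCoord_monic i]
  simp [natDegree_squareCoord]

/-- If `p = ∏ i ∈ s, squareCoord i` and `h ≠ 0`, then `p' h + 2 p h'` has degree
`deg p + deg h - 1`, unless `p` and `h` are both constant in `T`. -/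
theorem coeff_prod_squareCoord_ne_zero {s : Finset (Fin 3)} {h : EvenRing} (h0 : h ≠ 0) {n : ℕ}
    (hn : s.card + h.natDegree = n + 1) :
    (Polynomial.derivative (∏ i ∈ s, squareCoord i) * h +
      2 * ((∏ i ∈ s, squareCoord i) * Polynomial.derivative h)).coeff n ≠ 0 := by
  rw [coeff_derivative_mul_add (Polynomial.monic_prod_of_monic _ _ fun i _ => squareCoord_monic i)
    h (by rw [natDegree_prod_squareCoord, hn]), natDegree_prod_squareCoord]
  refine mul_ne_zero (Nat.cast_ne_zero.2 (by omega)) ?_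
  rwa [Ne, Polynomial.leadingCoeff_eq_zero]

/-- An equation `V₁ g = evenHom r`, for the quadratic part `V₁`, splits into one equation in each
parity class. -/
theorem exists_parity_equations {g : MvPolynomial (Fin 3) ℝ} {r : EvenRing}
    (hg : lieDerivation quadraticPart g = evenHom r) :
    ∃ h : Finset (Fin 3) → EvenRing, g = ∑ s, (∏ i ∈ s, X i) * evenHom (h s) ∧
      ∀ s, Polynomial.derivative (∏ i ∈ s, squareCoord i) * h s +
        2 * ((∏ i ∈ s, squareCoord i) * Polynomial.derivative (h s)) =
          if s = Finset.univ then r else 0 := by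
  obtain ⟨h, rfl⟩ := exists_parity_decomposition g
  refine ⟨h, rfl, fun s => ?_⟩
  let q : Finset (Fin 3) → EvenRing := fun s =>
    Polynomial.derivative (∏ i ∈ s, squareCoord i) * h s +
        2 * ((∏ i ∈ s, squareCoord i) * Polynomial.derivative (h s))
  have h1 : ∑ s, (∏ i ∈ s, X i) * evenHom (q sᶜ - if s = ∅ then r else 0) = 0 := by
    simp only [map_sub, mul_sub, Finset.sum_sub_distrib]
    have hr : ∑ s : Finset (Fin 3), (∏ i ∈ s, X i) * evenHom (if s = ∅ then r else 0) =
        evenHom r := by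
      rw [Finset.sum_eq_single ∅ (fun s _ hs => by rw [if_neg hs, map_zero, mul_zero])
        (fun h => absurd (Finset.mem_univ _) h), if_pos rfl, Finset.prod_empty, one_mul]
    rw [hr, sub_eq_zero, ← hg, map_sum]
    symm
    refine Fintype.sum_equiv (Function.Involutive.toPerm compl compl_involutive) _ _ fun s => ?_
    rw [lieDerivation_quadraticPart_prod_mul]
    simp [q]
  have h2 := eq_zero_of_parity_decomposition h1 sᶜ
  rw [compl_compl, sub_eq_zero] at h2
  simpa [q] using h2

/-- The polynomial first integrals of the quadratic part are the polynomials in `x² - z²` and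
`y² - z²`. -/
theorem exists_integralHom_eq {f : MvPolynomial (Fin 3) ℝ}
    (hf : lieDerivation quadraticPart f = 0) : ∃ F, f = integralHom F := by
  obtain ⟨h, rfl, hh⟩ := exists_parity_equations (r := 0) (by rw [hf, map_zero])
  have h1 : ∀ s, s ≠ ∅ → h s = 0 := fun s hs => by
    by_contra h0
    have hc := Finset.card_pos.2 (Finset.nonempty_iff_ne_empty.2 hs)
    refine coeff_prod_squareCoord_ne_zero (s := s) h0 (n := s.card + (h s).natDegree - 1)
      (by omega) ?_
    rw [hh s, ite_self, Polynomial.coeff_zero]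
  have h2 : (h ∅).natDegree = 0 := by
    by_contra hd
    refine coeff_prod_squareCoord_ne_zero (s := ∅) (h := h ∅) (n := (h ∅).natDegree - 1)
      (fun h0 => hd (by rw [h0, Polynomial.natDegree_zero])) (by simp; omega) ?_
    rw [hh, ite_self, Polynomial.coeff_zero]
  refine ⟨(h ∅).coeff 0, ?_⟩
  rw [Finset.sum_eq_single ∅ (fun s _ hs => by rw [h1 s hs, map_zero, mul_zero])
    (fun h => absurd (Finset.mem_univ _) h), Finset.prod_empty, one_mul,
    Polynomial.eq_C_of_natDegree_eq_zero h2, evenHom_C, Polynomial.coeff_C_zero]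

/-- An element of the image of the quadratic part inside `ℝ[x², y², z²]` is zero or has degree
at least `2` in `T`: it comes from `xyz · evenHom h`, and `p = T(T + α)(T + β)` is cubic. -/
theorem eq_zero_of_lieDerivation_eq_evenHom {g : MvPolynomial (Fin 3) ℝ} {r : EvenRing}
    (hg : lieDerivation quadraticPart g = evenHom r) (hr : r.natDegree ≤ 1) : r = 0 := by
  obtain ⟨h, -, hh⟩ := exists_parity_equations hg
  have h1 := hh Finset.univ
  rw [if_pos rfl] at h1
  by_cases h0 : h Finset.univ = 0
  · simpa [h0] using h1.symm
  · refine absurd ?_ (coeff_prod_squareCoord_ne_zero (s := Finset.univ) h0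
      (n := 2 + (h Finset.univ).natDegree) (by simp; omega))
    rw [h1]
    exact Polynomial.coeff_eq_zero_of_natDegree_lt (by omega)

/-! ### Homogeneous components of a Darboux polynomial with constant cofactor -/

theorem lieDerivation_linearPart_integralHom (a b : ℝ) (F : MvPolynomial (Fin 2) ℝ) :
    lieDerivation (linearPart a b) (integralHom F) =
      2 * integralHom (C a * (X 0 * pderiv 0 F) + C b * (X 1 * pderiv 1 F)) +
      2 * X 2 ^ 2 * integralHom (C (a - 1) * pderiv 0 F + C (b - 1) * pderiv 1 F) := by
  induction F using MvPolynomial.induction_on with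
  | C r => simp
  | add p q hp hq =>
    simp only [map_add, hp, hq, mul_add]
    ring
  | mul_X p i hp =>
    rw [map_mul, Derivation.leibniz, hp]
    fin_cases i <;>
    · simp [integralHom_X_zero, integralHom_X_one, lieDerivation_X, linearPart,
        Derivation.leibniz, Derivation.leibniz_pow]
      ring

/-- The two equations satisfied by a homogeneous component, written in `α` and `β`. -/
theorem exists_integralHom_equations {a b c : ℝ} {f g : MvPolynomial (Fin 3) ℝ}
    (hf : lieDerivation quadraticPart f = 0)
    (hg : lieDerivation quadraticPart g + lieDerivation (linearPart a b) f = C c * f) :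
    ∃ F, f = integralHom F ∧
      C c * F = 2 * (C a * (X 0 * pderiv 0 F) + C b * (X 1 * pderiv 1 F)) ∧
      C (a - 1) * pderiv 0 F + C (b - 1) * pderiv 1 F = 0 := by
  obtain ⟨F, rfl⟩ := exists_integralHom_eq hf
  refine ⟨F, rfl, ?_⟩
  set E := C a * (X 0 * pderiv 0 F) + C b * (X 1 * pderiv 1 F) with hE
  set W := C (a - 1) * pderiv 0 F + C (b - 1) * pderiv 1 F with hW
  have h1 : lieDerivation quadraticPart g =
      evenHom (Polynomial.C (-2 * W) * Polynomial.X + Polynomial.C (C c * F - 2 * E)) := by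
    rw [lieDerivation_linearPart_integralHom, ← hE, ← hW] at hg
    simp only [map_add, map_mul, map_sub, map_neg, evenHom_C, evenHom_X, integralHom_C, map_ofNat]
    linear_combination hg
  have h2 := eq_zero_of_lieDerivation_eq_evenHom h1 Polynomial.natDegree_linear_le
  have h3 := congrArg (Polynomial.coeff · 0) h2
  have h4 := congrArg (Polynomial.coeff · 1) h2
  simp only [Polynomial.coeff_add, Polynomial.coeff_C_mul, Polynomial.coeff_X_zero, mul_zero,
    Polynomial.coeff_C_zero, zero_add, Polynomial.coeff_zero] at h3
  simp only [Polynomial.coeff_add, Polynomial.coeff_C_mul, Polynomial.coeff_X_one, mul_one,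
    Polynomial.coeff_C_succ, add_zero, Polynomial.coeff_zero] at h4
  exact ⟨sub_eq_zero.1 h3, by simpa using h4⟩

/-- Every homogeneous component of a Darboux polynomial with constant cofactor is a first integral
of the quadratic part, and a Darboux polynomial of the linear part unless it vanishes. -/
theorem lieDerivation_homogeneousComponent {a b c : ℝ} {f : MvPolynomial (Fin 3) ℝ}
    (hf : lieDerivation (d2PlusField a b) f = C c * f) (m : ℕ) :
    lieDerivation quadraticPart (homogeneousComponent m f) = 0 ∧
      lieDerivation (linearPart a b) (homogeneousComponent m f) =
        C c * homogeneousComponent m f := by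
  rw [d2PlusField_eq, lieDerivation_add] at hf
  have hlin : ∀ m, homogeneousComponent m (lieDerivation (linearPart a b) f) =
      lieDerivation (linearPart a b) (homogeneousComponent m f) := fun m =>
    homogeneousComponent_lieDerivation (linearPart_isHomogeneous a b) f m
  have hsucc : ∀ m, lieDerivation (linearPart a b) (homogeneousComponent (m + 1) f) +
      lieDerivation quadraticPart (homogeneousComponent m f) =
        C c * homogeneousComponent (m + 1) f := fun m => by
    rw [← homogeneousComponent_C_mul, ← hf, map_add, hlin,
      homogeneousComponent_lieDerivation quadraticPart_isHomogeneous]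
  have hzero : lieDerivation (linearPart a b) (homogeneousComponent 0 f) =
        C c * homogeneousComponent 0 f := by
    rw [← homogeneousComponent_C_mul, ← hf, map_add, hlin,
      homogeneousComponent_lieDerivation_of_lt quadraticPart_isHomogeneous f one_pos, add_zero]
  -- descending induction on the degree, starting above the degree of `f`
  have key : ∀ n m, f.totalDegree < m + n →
      lieDerivation quadraticPart (homogeneousComponent m f) = 0 ∧
        lieDerivation (linearPart a b) (homogeneousComponent m f) =
          C c * homogeneousComponent m f := by
    intro n
    induction n with
    | zero =>
      intro m hm
      rw [homogeneousComponent_eq_zero _ _ (by simpa using hm)]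
      simp
    | succ n ih =>
      intro m hm
      have hq : lieDerivation quadraticPart (homogeneousComponent m f) = 0 := by
        have h1 := hsucc m
        rwa [(ih (m + 1) (by omega)).2, add_eq_left] at h1
      refine ⟨hq, ?_⟩
      cases m with
      | zero => exact hzero
      | succ m =>
        have h1 := hsucc m
        obtain ⟨F, hF, hE, hW⟩ := exists_integralHom_equations hq ((add_comm _ _).trans h1)
        rw [hF, lieDerivation_linearPart_integralHom, hW, map_zero, mul_zero, add_zero,
          ← integralHom_C, ← map_mul, hE, map_mul, map_ofNat]
  exact key (f.totalDegree + 1) m (by omega)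

/-! ### Generating the homogeneous components -/

theorem DarbouxGenerated.pow {n : ℕ} {v : Fin n → MvPolynomial (Fin n) ℝ}
    {S : Set (MvPolynomial (Fin n) ℝ)} {f : MvPolynomial (Fin n) ℝ} {d : ℝ} {k : ℕ}
    (hf : k ≠ 0 → DarbouxGenerated v S f (C d)) :
    DarbouxGenerated v S (f ^ k) (C (k * d)) := by
  induction k with
  | zero => simpa using DarbouxGenerated.const (v := v) (S := S) 1
  | succ k ih =>
    have h1 := (ih fun _ => hf k.succ_ne_zero).mul (hf k.succ_ne_zero)
    rw [← C_add] at h1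
    rwa [pow_succ, Nat.cast_succ, add_one_mul]

theorem DarbouxGenerated.sum {n : ℕ} {v : Fin n → MvPolynomial (Fin n) ℝ}
    {S : Set (MvPolynomial (Fin n) ℝ)} {ι : Type*} {s : Finset ι} (hs : s.Nonempty)
    {f : ι → MvPolynomial (Fin n) ℝ} {k : MvPolynomial (Fin n) ℝ}
    (hf : ∀ i ∈ s, DarbouxGenerated v S (f i) k) :
    DarbouxGenerated v S (∑ i ∈ s, f i) k := by
  induction hs using Finset.Nonempty.cons_induction with
  | singleton i => simpa using hf i
  | cons i s hi hs ih =>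
    rw [Finset.sum_cons]
    exact (hf i (by simp)).add (ih fun j hj => hf j (by simp [hj]))

/-- A polynomial `F` in two expressions `φ (X 0)` and `φ (X 1)` is generated, provided that its
monomials all yield the cofactor `c` and involve only those of the two that are generated. -/
theorem DarbouxGenerated.of_monomials {n : ℕ} {v : Fin n → MvPolynomial (Fin n) ℝ}
    {S : Set (MvPolynomial (Fin n) ℝ)}
    (φ : MvPolynomial (Fin 2) ℝ →ₐ[ℝ] MvPolynomial (Fin n) ℝ) {F : MvPolynomial (Fin 2) ℝ}
    (hF : F ≠ 0) {c : ℝ} (d : Fin 2 → ℝ)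
    (hgen : ∀ m ∈ F.support, ∀ i, m i ≠ 0 → DarbouxGenerated v S (φ (X i)) (C (d i)))
    (hc : ∀ m ∈ F.support, c = m 0 * d 0 + m 1 * d 1) :
    DarbouxGenerated v S (φ F) (C c) := by
  rw [F.as_sum, map_sum]
  refine DarbouxGenerated.sum (support_nonempty.2 hF) fun m hm => ?_
  have h1 := (DarbouxGenerated.const (v := v) (S := S) (coeff m F)).mul
    ((DarbouxGenerated.pow (hgen m hm 0)).mul (DarbouxGenerated.pow (hgen m hm 1)))
  rw [zero_add, ← C_add, ← hc m hm] at h1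
  convert h1 using 1
  rw [monomial_eq, Finsupp.prod_fintype _ _ (fun _ => pow_zero _), Fin.prod_univ_two]
  simp [← algebraMap_eq]

theorem coeff_X_mul_pderiv {σ R : Type*} [CommSemiring R] (i : σ) (F : MvPolynomial σ R)
    (m : σ →₀ ℕ) : coeff m (X i * pderiv i F) = m i * coeff m F := by
  classical
  induction F using MvPolynomial.induction_on' with
  | monomial n r =>
    rw [X_mul_pderiv_monomial, coeff_smul, coeff_monomial]
    split_ifs with h <;> simp [h]
  | add p q hp hq => rw [map_add, mul_add, coeff_add, hp, hq, coeff_add, mul_add]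

theorem eq_of_mem_support {a b c : ℝ} {F : MvPolynomial (Fin 2) ℝ}
    (hE : C c * F = 2 * (C a * (X 0 * pderiv 0 F) + C b * (X 1 * pderiv 1 F)))
    {m : Fin 2 →₀ ℕ} (hm : m ∈ F.support) : c = m 0 * (2 * a) + m 1 * (2 * b) := by
  have h1 := congrArg (coeff m) hE
  rw [← map_ofNat C 2, coeff_C_mul, coeff_C_mul, coeff_add, coeff_C_mul, coeff_C_mul,
    coeff_X_mul_pderiv, coeff_X_mul_pderiv] at h1
  apply mul_right_cancel₀ (mem_support_iff.1 hm)
  linear_combination h1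

theorem d2PlusBasic_isDarboux_left (b : ℝ) :
    IsDarboux (d2PlusField 1 b) (X 0 ^ 2 - X 2 ^ 2) (C 2) := by
  refine ⟨fun h => ?_, ?_⟩
  · simpa using congrArg (eval ![1, 0, 0]) h
  · have h2 : (C 2 : MvPolynomial (Fin 3) ℝ) = 2 := map_ofNat C 2
    rw [lieDeriv_eq_lieDerivation]
    simp [Derivation.leibniz_pow, lieDerivation_X, d2PlusField, h2]
    ring

theorem d2PlusBasic_isDarboux_right (a : ℝ) :
    IsDarboux (d2PlusField a 1) (X 1 ^ 2 - X 2 ^ 2) (C 2) := by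
  refine ⟨fun h => ?_, ?_⟩
  · simpa using congrArg (eval ![0, 1, 0]) h
  · have h2 : (C 2 : MvPolynomial (Fin 3) ℝ) = 2 := map_ofNat C 2
    rw [lieDeriv_eq_lieDerivation]
    simp [Derivation.leibniz_pow, lieDerivation_X, d2PlusField, h2]
    ring

theorem d2PlusBasic_isDarboux_diag (a : ℝ) :
    IsDarboux (d2PlusField a a) (X 0 ^ 2 - X 1 ^ 2) (C (2 * a)) := by
  refine ⟨fun h => ?_, ?_⟩
  · simpa using congrArg (eval ![1, 0, 0]) h
  · have h2 : (C 2 : MvPolynomial (Fin 3) ℝ) = 2 := map_ofNat C 2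
    rw [lieDeriv_eq_lieDerivation]
    simp [Derivation.leibniz_pow, lieDerivation_X, d2PlusField, h2]
    ring

/-- For `a ≠ b` the monomials `αⁱ⁺¹ βʲ` and `αⁱ βʲ⁺¹` have different weights, so that the two terms
of the second equation vanish separately. -/
theorem darbouxGenerated_integralHom_of_ne {a b c : ℝ} (hab : a ≠ b) {F : MvPolynomial (Fin 2) ℝ}
    (hF : F ≠ 0)
    (hE : C c * F = 2 * (C a * (X 0 * pderiv 0 F) + C b * (X 1 * pderiv 1 F)))
    (hW : C (a - 1) * pderiv 0 F + C (b - 1) * pderiv 1 F = 0) :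
    DarbouxGenerated (d2PlusField a b) (d2PlusBasic a b) (integralHom F) (C c) := by
  have hcoeff : ∀ n : Fin 2 →₀ ℕ,
      (a - 1) * (coeff (n + Finsupp.single 0 1) F * (n 0 + 1)) +
        (b - 1) * (coeff (n + Finsupp.single 1 1) F * (n 1 + 1)) = 0 := fun n => by
    have h1 := congrArg (coeff n) hW
    rwa [coeff_add, coeff_C_mul, coeff_C_mul, coeff_pderiv, coeff_pderiv, coeff_zero] at h1
  have hsep : ∀ n : Fin 2 →₀ ℕ, n + Finsupp.single 0 1 ∈ F.support →
      n + Finsupp.single 1 1 ∈ F.support → False := fun n h0 h1 => by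
    have e0 := eq_of_mem_support hE h0
    have e1 := eq_of_mem_support hE h1
    simp at e0 e1
    exact hab (by linarith)
  refine DarbouxGenerated.of_monomials integralHom hF ![2 * a, 2 * b] (fun m hm i hi => ?_)
    (fun m hm => eq_of_mem_support hE hm)
  obtain ⟨n, rfl⟩ : ∃ n, m = n + Finsupp.single i 1 :=
    ⟨m - Finsupp.single i 1, (tsub_add_cancel_of_le (by simpa [Nat.one_le_iff_ne_zero])).symm⟩
  have h1 := hcoeff n
  fin_cases i
  · have h2 : coeff (n + Finsupp.single 1 1) F = 0 := notMem_support_iff.1 (hsep n hm)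
    rw [h2, zero_mul, mul_zero, add_zero] at h1
    obtain rfl : a = 1 := by
      rcases mul_eq_zero.1 h1 with h | h
      · linarith
      · exact absurd h (mul_ne_zero (mem_support_iff.1 hm) (by positivity))
    refine DarbouxGenerated.basic (Or.inl ⟨rfl, integralHom_X_zero⟩) ?_
    simpa [integralHom_X_zero] using d2PlusBasic_isDarboux_left b
  · have h2 : coeff (n + Finsupp.single 0 1) F = 0 :=
      notMem_support_iff.1 fun h => hsep n h hm
    rw [h2, zero_mul, mul_zero, zero_add] at h1
    obtain rfl : b = 1 := by
      rcases mul_eq_zero.1 h1 with h | h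
      · linarith
      · exact absurd h (mul_ne_zero (mem_support_iff.1 hm) (by positivity))
    refine DarbouxGenerated.basic (Or.inr (Or.inl ⟨rfl, integralHom_X_one⟩)) ?_
    simpa [integralHom_X_one] using d2PlusBasic_isDarboux_right a

/-- The automorphism of `ℝ[α, β]` with `α ↦ α + β` and `β ↦ β`. -/
noncomputable def shear : MvPolynomial (Fin 2) ℝ →ₐ[ℝ] MvPolynomial (Fin 2) ℝ :=
  aeval ![X 0 + X 1, X 1]

/-- The inverse of `shear`. -/
noncomputable def unshear : MvPolynomial (Fin 2) ℝ →ₐ[ℝ] MvPolynomial (Fin 2) ℝ :=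
  aeval ![X 0 - X 1, X 1]

theorem unshear_shear (F : MvPolynomial (Fin 2) ℝ) : unshear (shear F) = F := by
  have : unshear.comp shear = AlgHom.id ℝ _ := by
    ext i
    fin_cases i <;> simp [shear, unshear]
  exact DFunLike.congr_fun this F

theorem pderiv_shear (F : MvPolynomial (Fin 2) ℝ) :
    pderiv 0 (shear F) = shear (pderiv 0 F) ∧
      pderiv 1 (shear F) = shear (pderiv 0 F + pderiv 1 F) := by
  induction F using MvPolynomial.induction_on with
  | C r => simp [shear]
  | add p q hp hq =>
    simp only [map_add, hp, hq, true_and]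
    ring
  | mul_X p i hp =>
    simp only [map_mul, Derivation.leibniz, hp.1, hp.2]
    fin_cases i <;> simp [shear] <;> ring

theorem darbouxGenerated_integralHom_diag {a c : ℝ} {F : MvPolynomial (Fin 2) ℝ}
    (hF : F ≠ 0)
    (hE : C c * F = 2 * (C a * (X 0 * pderiv 0 F) + C a * (X 1 * pderiv 1 F)))
    (hW : C (a - 1) * pderiv 0 F + C (a - 1) * pderiv 1 F = 0) :
    DarbouxGenerated (d2PlusField a a) (d2PlusBasic a a) (integralHom F) (C c) := by
  -- `G` expresses the polynomial in `x² - y²` and `y² - z²`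
  set G := shear F with hG
  have hG0 : G ≠ 0 := fun h => hF (by rw [← unshear_shear F, ← hG, h, map_zero])
  obtain ⟨h0, h1⟩ := pderiv_shear F
  rw [← hG] at h0 h1
  have hE' : C c * G = 2 * (C a * (X 0 * pderiv 0 G) + C a * (X 1 * pderiv 1 G)) := by
    have := congrArg shear hE
    rw [h0, h1]
    simp only [map_mul, map_add, map_ofNat, ← hG] at this ⊢
    simp [shear] at this ⊢
    linear_combination this
  have hW' : C (a - 1) * pderiv 1 G = 0 := by
    have := congrArg shear hW
    rw [← mul_add, map_mul, ← h1, map_zero] at this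
    simpa [shear] using this
  rw [← unshear_shear F, ← hG, ← AlgHom.comp_apply]
  refine DarbouxGenerated.of_monomials (integralHom.comp unshear) hG0 ![2 * a, 2 * a]
    (fun m hm i hi => ?_) (fun m hm => eq_of_mem_support hE' hm)
  fin_cases i
  · have hX : (integralHom.comp unshear) (X 0) = X 0 ^ 2 - X 1 ^ 2 := by
      simp [unshear, integralHom_X_zero, integralHom_X_one]
    refine DarbouxGenerated.basic (Or.inr (Or.inr ⟨rfl, hX⟩)) ?_
    simpa [hX] using d2PlusBasic_isDarboux_diag a
  · have hX : (integralHom.comp unshear) (X 1) = X 1 ^ 2 - X 2 ^ 2 := by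
      simp [unshear, integralHom_X_one]
    obtain rfl : a = 1 := by
      have h2 := congrArg (coeff m) (congrArg (X 1 * ·) hW')
      simp only [mul_zero, coeff_zero] at h2
      rw [mul_left_comm, coeff_C_mul, coeff_X_mul_pderiv] at h2
      rcases mul_eq_zero.1 h2 with h | h
      · linarith
      · exact absurd h (mul_ne_zero (Nat.cast_ne_zero.2 hi) (mem_support_iff.1 hm))
    refine DarbouxGenerated.basic (Or.inr (Or.inl ⟨rfl, hX⟩)) ?_
    simpa [hX] using d2PlusBasic_isDarboux_right 1

theorem darbouxGenerated_of_isDarboux_C {a b c : ℝ} {f : MvPolynomial (Fin 3) ℝ}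
    (hf : IsDarboux (d2PlusField a b) f (C c)) :
    DarbouxGenerated (d2PlusField a b) (d2PlusBasic a b) f (C c) := by
  classical
  have hf' := hf.2
  rw [lieDeriv_eq_lieDerivation] at hf'
  have hsum := sum_homogeneousComponent f
  rw [← Finset.sum_filter_ne_zero] at hsum
  rw [← hsum]
  refine DarbouxGenerated.sum ?_ fun m hm => ?_
  · by_contra h
    rw [Finset.not_nonempty_iff_eq_empty.1 h, Finset.sum_empty] at hsum
    exact hf.1 hsum.symm
  · obtain ⟨hq, hl⟩ := lieDerivation_homogeneousComponent hf' m
    obtain ⟨F, hF, hE, hW⟩ := exists_integralHom_equations (g := 0) hq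
      (by rw [map_zero, zero_add, hl])
    have hF0 : F ≠ 0 := fun h => (Finset.mem_filter.1 hm).2 (by rw [hF, h, map_zero])
    rw [hF]
    by_cases hab : a = b
    · subst hab
      exact darbouxGenerated_integralHom_diag hF0 hE hW
    · exact darbouxGenerated_integralHom_of_ne hab hF0 hE hW

/-! ### Reduction of arbitrary cofactors to constant ones -/

/-- The substitution `xᵢ ↦ εᵢ xᵢ`. -/
noncomputable def rescale (ε : Fin 3 → ℝ) : MvPolynomial (Fin 3) ℝ →ₐ[ℝ] MvPolynomial (Fin 3) ℝ :=
  aeval fun i => C (ε i) * X i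

theorem rescale_X (ε : Fin 3 → ℝ) (i : Fin 3) : rescale ε (X i) = C (ε i) * X i := by
  simp [rescale]

theorem rescale_C (ε : Fin 3 → ℝ) (r : ℝ) : rescale ε (C r) = C r := by
  simp [rescale]

theorem rescale_ne_zero {ε : Fin 3 → ℝ} (hε : ∀ i, ε i * ε i = 1) {f : MvPolynomial (Fin 3) ℝ}
    (hf : f ≠ 0) : rescale ε f ≠ 0 := fun h => hf <| by
  have h1 : (rescale ε).comp (rescale ε) = AlgHom.id ℝ _ := by
    ext1 i
    rw [AlgHom.comp_apply, rescale_X, map_mul, rescale_C, rescale_X, ← mul_assoc, ← C_mul, hε]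
    simp
  have h2 := DFunLike.congr_fun h1 f
  rw [AlgHom.comp_apply, h, map_zero] at h2
  exact h2.symm

/-- Sign changes of the coordinates with product `1` preserve the vector field. -/
theorem lieDerivation_rescale (a b : ℝ) {ε : Fin 3 → ℝ} (h0 : ε 1 * ε 2 = ε 0)
    (h1 : ε 0 * ε 2 = ε 1) (h2 : ε 0 * ε 1 = ε 2) (f : MvPolynomial (Fin 3) ℝ) :
    lieDerivation (d2PlusField a b) (rescale ε f) =
      rescale ε (lieDerivation (d2PlusField a b) f) := by
  induction f using MvPolynomial.induction_on with
  | C r => rw [rescale_C, lieDerivation_C, map_zero]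
  | add p q hp hq => simp only [map_add, hp, hq]
  | mul_X p i hp =>
    have hi : lieDerivation (d2PlusField a b) (rescale ε (X i)) =
        rescale ε (lieDerivation (d2PlusField a b) (X i)) := by
      rw [rescale_X, Derivation.leibniz, lieDerivation_C, smul_zero, add_zero, smul_eq_mul,
        lieDerivation_X]
      have e0 := congrArg (C (σ := Fin 3)) h0
      have e1 := congrArg (C (σ := Fin 3)) h1
      have e2 := congrArg (C (σ := Fin 3)) h2
      rw [C_mul] at e0 e1 e2
      fin_cases i
      · simp only [d2PlusField, Fin.zero_eta, Matrix.cons_val_zero, map_add, map_mul, rescale_X,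
          rescale_C]
        linear_combination -(X 1 * X 2) * e0
      · simp only [d2PlusField, Fin.mk_one, Matrix.cons_val_one, Matrix.cons_val_zero, map_add,
          map_mul, rescale_X, rescale_C]
        linear_combination -(X 0 * X 2) * e1
      · simp only [d2PlusField, Fin.reduceFinMk, Matrix.cons_val, map_add, map_mul, rescale_X]
        linear_combination -(X 0 * X 1) * e2
    rw [map_mul, Derivation.leibniz, Derivation.leibniz, map_add, hi, hp]
    simp only [smul_eq_mul, map_mul]

theorem IsDarboux.rescale {a b : ℝ} {ε : Fin 3 → ℝ} (h : ∀ i, ε i * ε i = 1)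
    (h0 : ε 1 * ε 2 = ε 0) (h1 : ε 0 * ε 2 = ε 1) (h2 : ε 0 * ε 1 = ε 2)
    {f k : MvPolynomial (Fin 3) ℝ} (hf : IsDarboux (d2PlusField a b) f k) :
    IsDarboux (d2PlusField a b) (rescale ε f) (rescale ε k) := by
  refine ⟨rescale_ne_zero h hf.1, ?_⟩
  rw [lieDeriv_eq_lieDerivation, lieDerivation_rescale a b h0 h1 h2, ← lieDeriv_eq_lieDerivation,
    hf.2, map_mul]

theorem IsDarboux.mul {n : ℕ} {v : Fin n → MvPolynomial (Fin n) ℝ}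
    {f g k l : MvPolynomial (Fin n) ℝ} (hf : IsDarboux v f k) (hg : IsDarboux v g l) :
    IsDarboux v (f * g) (k + l) := by
  refine ⟨mul_ne_zero hf.1 hg.1, ?_⟩
  have h1 := hf.2
  have h2 := hg.2
  rw [lieDeriv_eq_lieDerivation] at h1 h2 ⊢
  rw [Derivation.leibniz, h1, h2, smul_eq_mul, smul_eq_mul]
  ring

theorem IsDarboux.totalDegree_cofactor_le {a b : ℝ} {f k : MvPolynomial (Fin 3) ℝ}
    (hf : IsDarboux (d2PlusField a b) f k) : k.totalDegree ≤ 1 := by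
  by_cases hk : k = 0
  · simp [hk]
  have h1 := totalDegree_lieDerivation_le (totalDegree_d2PlusField_le a b) f
  rw [← lieDeriv_eq_lieDerivation, hf.2, totalDegree_mul_of_isDomain hk hf.1] at h1
  omega

/-- Averaging over the sign changes with product `1` kills the linear terms. -/
theorem exists_sum_rescale_eq_C {k : MvPolynomial (Fin 3) ℝ} (hk : k.totalDegree ≤ 1) :
    ∃ c : ℝ, k + rescale ![1, -1, -1] k + (rescale ![-1, 1, -1] k + rescale ![-1, -1, 1] k) =
      C c := by
  have hmon : ∀ m ∈ k.support, ∃ c : ℝ, monomial m (coeff m k) +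
      rescale ![1, -1, -1] (monomial m (coeff m k)) +
      (rescale ![-1, 1, -1] (monomial m (coeff m k)) +
        rescale ![-1, -1, 1] (monomial m (coeff m k))) = C c := by
    intro m hm
    have hdeg := (le_totalDegree hm).trans hk
    rw [Finsupp.sum_fintype _ _ (fun _ => rfl), Fin.sum_univ_three] at hdeg
    rw [monomial_eq, Finsupp.prod_fintype _ _ (fun _ => pow_zero _), Fin.prod_univ_three]
    simp only [map_mul, map_pow, rescale_X, rescale_C]
    obtain ⟨h0, h1, h2⟩ | ⟨h0, h1, h2⟩ | ⟨h0, h1, h2⟩ | ⟨h0, h1, h2⟩ :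
        (m 0 = 0 ∧ m 1 = 0 ∧ m 2 = 0) ∨ (m 0 = 1 ∧ m 1 = 0 ∧ m 2 = 0) ∨
        (m 0 = 0 ∧ m 1 = 1 ∧ m 2 = 0) ∨ (m 0 = 0 ∧ m 1 = 0 ∧ m 2 = 1) := by omega
    · refine ⟨4 * coeff m k, ?_⟩
      have h4 : (C 4 : MvPolynomial (Fin 3) ℝ) = 4 := map_ofNat C 4
      simp [h0, h1, h2, h4]
      ring
    all_goals
      refine ⟨0, ?_⟩
      simp [h0, h1, h2]
  choose! c hc using hmon
  refine ⟨∑ m ∈ k.support, c m, ?_⟩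
  rw [map_sum, ← Finset.sum_congr rfl hc]
  simp only [Finset.sum_add_distrib, ← map_sum, ← k.as_sum]

theorem IsDarboux.exists_dvd_isDarboux_C {a b : ℝ} {f k : MvPolynomial (Fin 3) ℝ}
    (hf : IsDarboux (d2PlusField a b) f k) :
    ∃ (g : MvPolynomial (Fin 3) ℝ) (c : ℝ), IsDarboux (d2PlusField a b) g (C c) ∧ f ∣ g := by
  obtain ⟨c, hc⟩ := exists_sum_rescale_eq_C hf.totalDegree_cofactor_le
  have h1 := hf.rescale (ε := ![1, -1, -1]) (fun i => by fin_cases i <;> simp) (by simp)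
    (by simp) (by simp)
  have h2 := hf.rescale (ε := ![-1, 1, -1]) (fun i => by fin_cases i <;> simp) (by simp)
    (by simp) (by simp)
  have h3 := hf.rescale (ε := ![-1, -1, 1]) (fun i => by fin_cases i <;> simp) (by simp)
    (by simp) (by simp)
  refine ⟨_, c, hc ▸ (hf.mul h1).mul (h2.mul h3), ?_⟩
  exact (dvd_mul_right _ _).mul_right _

theorem mainTheorem2 (a b : ℝ) :
    -- the three basic Darboux polynomials and their cofactors
    (a = 1 → IsDarboux (d2PlusField a b) (X 0 ^ 2 - X 2 ^ 2) (C 2)) ∧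
    (b = 1 → IsDarboux (d2PlusField a b) (X 1 ^ 2 - X 2 ^ 2) (C 2)) ∧
    (a = b → IsDarboux (d2PlusField a b) (X 0 ^ 2 - X 1 ^ 2) (C (2 * a))) ∧
    -- every Darboux polynomial with constant cofactor is generated by them
    (∀ (f : MvPolynomial (Fin 3) ℝ) (c : ℝ), IsDarboux (d2PlusField a b) f (C c) →
      DarbouxGenerated (d2PlusField a b) (d2PlusBasic a b) f (C c)) ∧
    -- every Darboux polynomial, with any cofactor, is a factor of a generated one
    (∀ f k : MvPolynomial (Fin 3) ℝ, IsDarboux (d2PlusField a b) f k →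
      ∃ (g : MvPolynomial (Fin 3) ℝ) (c : ℝ), IsDarboux (d2PlusField a b) g (C c) ∧ f ∣ g ∧
        DarbouxGenerated (d2PlusField a b) (d2PlusBasic a b) g (C c)) := by
  refine ⟨?_, ?_, ?_, fun f c hf => darbouxGenerated_of_isDarboux_C hf, fun f k hf => ?_⟩
  · rintro rfl
    exact d2PlusBasic_isDarboux_left b
  · rintro rfl
    exact d2PlusBasic_isDarboux_right a
  · rintro rfl
    exact d2PlusBasic_isDarboux_diag a
  · obtain ⟨g, c, hg, hfg⟩ := hf.exists_dvd_isDarboux_C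
    exact ⟨g, c, hg, hfg, darbouxGenerated_of_isDarboux_C hg⟩
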